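/- All boxes are closed: an axis-parallel box in $\mathbb{R}^d$ is a product $I_1\times\cdots\times I_d$ of nonempty closed intervals of $\mathbb{R}$ (possibly degenerate or unbounded). For $S\subseteq\mathbb{R}^d$, a family of sets is called $S$-intersecting if all its members have a common point lying in $S$. A family may contain the same box several times, and $|F|$ counts members with multiplicity. **Theorem.** For every positive integer $d$ there are a number $c_d\in(0,1)$ and a function $\beta_d:(c_d,1]\to(0,1]$ such that the following holds: for every $S\subseteq\mathbb{R}^d$, every $\alpha\in(c_d,1]$ and every finite family $F$ of axis-parallel boxes in $\mathbb{R}^d$ with $|F|\ge 2$, if at least $\alpha\binom{|F|}{2}$ of the unordered pairs of members of $F$ are $S$-intersecting, then $F$ contains an $S$-intersecting subfamily of size at least $\beta_d(\alpha)\,|F|$. -/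

import Mathlib

/-- A closed axis-parallel box in `ℝ^d`: a product of `d` nonempty closed intervals of `ℝ`
(closed order-connected sets). The intervals may be degenerate or unbounded. -/
def IsAxisParallelBox {d : ℕ} (B : Set (Fin d → ℝ)) : Prop :=
  ∃ I : Fin d → Set ℝ,
    (∀ i, (I i).Nonempty ∧ IsClosed (I i) ∧ (I i).OrdConnected) ∧ B = Set.univ.pi I

/-- The subfamily `(F j)_{j ∈ J}` of the family `F` is `S`-intersecting: its members have a point
in common in `S`. -/
def IsSIntersecting {d n : ℕ} (S : Set (Fin d → ℝ)) (F : Fin n → Set (Fin d → ℝ))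
    (J : Finset (Fin n)) : Prop :=
  (S ∩ ⋂ j ∈ J, F j).Nonempty

open Classical in
/-- The number of (unordered) `S`-intersecting pairs of members of the family `F`. -/
noncomputable def numSIntersectingPairs {d n : ℕ} (S : Set (Fin d → ℝ))
    (F : Fin n → Set (Fin d → ℝ)) : ℕ :=
  ((Finset.powersetCard 2 (Finset.univ : Finset (Fin n))).filter
    (fun J => IsSIntersecting S F J)).card

/-! Pick a point of `S` in each `S`-intersecting pair. If no point of `S` lies in `ε n` boxes, each
chosen point lies in few boxes, so a union bound over random `m`-tuples yields `m` boxes that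
pairwise meet in `S`, with no chosen point lying in a third box. For large `m` this is impossible
(`exists_pair_point_mem_third_box`): colour `i < j < k` by one of the `2d` directions in which box
`j` lies strictly beyond the point `p i k`. A shift-graph argument gives `(i, j, k)` and `(j, k, l)`
the same colour; then `p j l`, in box `j`, and `p i k`, in box `k`, each lie strictly beyond the
other in one direction. -/

/-! ### Ramsey-type colouring of triples -/

/-- Among more than `2 ^ 2 ^ q` linearly ordered vertices, every colouring of the increasing triples
with `q` colours gives two consecutive triples `(i, j, k)`, `(j, k, l)` the same colour. -/
theorem exists_consecutive_triples_eq_color {V C : Type*} [Fintype V] [LinearOrder V] [Fintype C]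
    (hV : 2 ^ 2 ^ Fintype.card C < Fintype.card V) (f : V → V → V → C) :
    ∃ i j k l : V, i < j ∧ j < k ∧ k < l ∧ f i j k = f j k l := by
  classical
  by_contra! h
  -- `A i j` collects the colours of triples ending in `(i, j)`: `f i j k` lies in `A j k` but not
  -- in `A i j`. `B` repeats this one level down, so it embeds `V` into the double power set of `C`.
  let A : V → V → Set C := fun i j => {c | ∃ x, x < i ∧ f x i j = c}
  let B : V → Set (Set C) := fun j => {a | ∃ i, i < j ∧ A i j = a}
  have hA : ∀ i j k, i < j → j < k → A i j ≠ A j k := by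
    intro i j k hij hjk he
    have h1 : f i j k ∈ A j k := ⟨i, hij, rfl⟩
    rw [← he] at h1
    obtain ⟨x, hx, hxe⟩ := h1
    exact h x i j k hx hij hjk hxe
  have hB : ∀ j k, j < k → B j ≠ B k := by
    intro j k hjk he
    have h1 : A j k ∈ B k := ⟨j, hjk, rfl⟩
    rw [← he] at h1
    obtain ⟨i, hi, hie⟩ := h1
    exact hA i j k hi hjk hie
  have hinj : Function.Injective B := by
    intro j k he
    rcases lt_trichotomy j k with h1 | h1 | h1
    · exact absurd he (hB j k h1)
    · exact h1
    · exact absurd he.symm (hB k j h1)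
  have := Fintype.card_le_of_injective B hinj
  simp only [Fintype.card_set] at this
  omega

/-! ### Sampling tuples by a union bound -/

/-- The number of functions whose restriction along an embedding lies in a given finite set. -/
theorem card_filter_comp_embedding_mul_le {K M N : Type*} [Fintype K] [Fintype M] [Fintype N]
    [DecidableEq K] [DecidableEq M] [DecidableEq N] (e : K ↪ M) (P : Finset (K → N)) :
    (Finset.univ.filter fun g : M → N => g ∘ e ∈ P).card * Fintype.card N ^ Fintype.card K ≤
      P.card * Fintype.card N ^ Fintype.card M := by
  classical
  have hinj : (Finset.univ.filter fun g : M → N => g ∘ e ∈ P).card ≤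
      (P ×ˢ (Finset.univ : Finset ({x // x ∉ Set.range e} → N))).card := by
    refine Finset.card_le_card_of_injOn (fun g => (g ∘ e, fun x => g x.1)) ?_ ?_
    · intro g hg
      simpa using hg
    · intro g _ g' _ he
      simp only [Prod.mk.injEq] at he
      funext x
      by_cases hx : x ∈ Set.range e
      · obtain ⟨y, rfl⟩ := hx
        exact congrFun he.1 y
      · exact congrFun he.2 ⟨x, hx⟩
  have hcard : Fintype.card {x // x ∉ Set.range e} + Fintype.card K = Fintype.card M := by
    have h1 : Fintype.card {x // x ∈ Set.range e} = Fintype.card K :=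
      (Fintype.card_congr (Equiv.ofInjective e e.injective)).symm
    have h2 := Fintype.card_subtype_compl (fun x => x ∈ Set.range e)
    have h3 := Fintype.card_subtype_le (fun x => x ∈ Set.range e)
    omega
  rw [Finset.card_product, Finset.card_univ, Fintype.card_fun] at hinj
  calc _ ≤ P.card * Fintype.card N ^ Fintype.card {x // x ∉ Set.range e} *
        Fintype.card N ^ Fintype.card K := Nat.mul_le_mul_right _ hinj
    _ = _ := by rw [mul_assoc, ← pow_add, hcard]

/-- The functions containing some bad tuple, when bad tuples have density at most `ε`. -/
theorem card_exists_bad_embedding_le {k m n : ℕ} (hn : 0 < n) (P : Finset (Fin k → Fin n))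
    {ε : ℝ} (hP : (P.card : ℝ) ≤ ε * (n : ℝ) ^ k) :
    ((Finset.univ.filter fun g : Fin m → Fin n => ∃ e : Fin k ↪ Fin m, g ∘ e ∈ P).card : ℝ) ≤
      (m : ℝ) ^ k * (ε * (n : ℝ) ^ m) := by
  classical
  have hn' : (0 : ℝ) < n := by exact_mod_cast hn
  have hε : 0 ≤ ε := by
    by_contra! h
    have := mul_neg_of_neg_of_pos h (pow_pos hn' k)
    have h2 : (0 : ℝ) ≤ P.card := Nat.cast_nonneg _
    linarith
  have hone : ∀ e : Fin k ↪ Fin m,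
      ((Finset.univ.filter fun g : Fin m → Fin n => g ∘ e ∈ P).card : ℝ) ≤ ε * (n : ℝ) ^ m := by
    intro e
    have h1 := card_filter_comp_embedding_mul_le e P
    simp only [Fintype.card_fin] at h1
    have h2 : ((Finset.univ.filter fun g : Fin m → Fin n => g ∘ e ∈ P).card : ℝ) * (n : ℝ) ^ k ≤
        P.card * (n : ℝ) ^ m := by exact_mod_cast h1
    have h3 : (P.card : ℝ) * (n : ℝ) ^ m ≤ ε * (n : ℝ) ^ k * (n : ℝ) ^ m := by gcongr
    refine le_of_mul_le_mul_right ?_ (pow_pos hn' k)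
    linarith [mul_right_comm ε ((n : ℝ) ^ k) ((n : ℝ) ^ m)]
  have hsub : (Finset.univ.filter fun g : Fin m → Fin n => ∃ e : Fin k ↪ Fin m, g ∘ e ∈ P) ⊆
      (Finset.univ : Finset (Fin k ↪ Fin m)).biUnion
        fun e => Finset.univ.filter fun g : Fin m → Fin n => g ∘ e ∈ P := by
    intro g hg
    simpa using hg
  have hemb : (Fintype.card (Fin k ↪ Fin m) : ℝ) ≤ (m : ℝ) ^ k := by
    have := Fintype.card_le_of_injective (fun e : Fin k ↪ Fin m => (e : Fin k → Fin m))
      DFunLike.coe_injective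
    rw [Fintype.card_fun, Fintype.card_fin, Fintype.card_fin] at this
    exact_mod_cast this
  calc ((Finset.univ.filter fun g : Fin m → Fin n => ∃ e : Fin k ↪ Fin m, g ∘ e ∈ P).card : ℝ)
      ≤ ∑ e : Fin k ↪ Fin m,
          ((Finset.univ.filter fun g : Fin m → Fin n => g ∘ e ∈ P).card : ℝ) := by
        exact_mod_cast (Finset.card_le_card hsub).trans Finset.card_biUnion_le
    _ ≤ ∑ _e : Fin k ↪ Fin m, ε * (n : ℝ) ^ m := Finset.sum_le_sum fun e _ => hone e
    _ = Fintype.card (Fin k ↪ Fin m) * (ε * (n : ℝ) ^ m) := by simp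
    _ ≤ _ := by gcongr

/-- If bad pairs and bad triples are rare, some `m`-tuple contains neither. -/
theorem exists_tuple_avoiding {m n : ℕ} (hm : 1 ≤ m) (hn : 0 < n)
    (P : Finset (Fin 2 → Fin n)) (Q : Finset (Fin 3 → Fin n))
    (hP : (P.card : ℝ) ≤ 1 / (4 * (m : ℝ) ^ 3) * (n : ℝ) ^ 2)
    (hQ : (Q.card : ℝ) ≤ 1 / (4 * (m : ℝ) ^ 3) * (n : ℝ) ^ 3) :
    ∃ g : Fin m → Fin n, (∀ e : Fin 2 ↪ Fin m, g ∘ e ∉ P) ∧ ∀ e : Fin 3 ↪ Fin m, g ∘ e ∉ Q := by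
  classical
  by_contra! h
  have h2 := card_exists_bad_embedding_le (m := m) hn P hP
  have h3 := card_exists_bad_embedding_le (m := m) hn Q hQ
  have hcover : (Finset.univ : Finset (Fin m → Fin n)) ⊆
      (Finset.univ.filter fun g : Fin m → Fin n => ∃ e : Fin 2 ↪ Fin m, g ∘ e ∈ P) ∪
      (Finset.univ.filter fun g : Fin m → Fin n => ∃ e : Fin 3 ↪ Fin m, g ∘ e ∈ Q) := by
    intro g _
    simp only [Finset.mem_union, Finset.mem_filter, Finset.mem_univ, true_and]
    by_cases hg : ∃ e : Fin 2 ↪ Fin m, g ∘ e ∈ P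
    · exact Or.inl hg
    · push Not at hg
      exact Or.inr (h g hg)
  have hc := (Finset.card_le_card hcover).trans (Finset.card_union_le _ _)
  rw [Finset.card_univ, Fintype.card_fun, Fintype.card_fin, Fintype.card_fin] at hc
  -- Each kind of badness spoils at most a quarter of all tuples.
  have hc' : (n : ℝ) ^ m ≤ (m : ℝ) ^ 2 * (1 / (4 * (m : ℝ) ^ 3) * (n : ℝ) ^ m) +
      (m : ℝ) ^ 3 * (1 / (4 * (m : ℝ) ^ 3) * (n : ℝ) ^ m) := by
    refine le_trans ?_ (add_le_add h2 h3)
    exact_mod_cast hc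
  have hm' : (1 : ℝ) ≤ m := by exact_mod_cast hm
  have hpow : (m : ℝ) ^ 2 ≤ (m : ℝ) ^ 3 := pow_le_pow_right₀ hm' (by norm_num)
  have hnm : (0 : ℝ) < (n : ℝ) ^ m := pow_pos (by exact_mod_cast hn) m
  have hle : (m : ℝ) ^ 2 * (1 / (4 * (m : ℝ) ^ 3) * (n : ℝ) ^ m) ≤
      (m : ℝ) ^ 3 * (1 / (4 * (m : ℝ) ^ 3) * (n : ℝ) ^ m) := by gcongr
  have heq : (m : ℝ) ^ 3 * (1 / (4 * (m : ℝ) ^ 3) * (n : ℝ) ^ m) = (n : ℝ) ^ m / 4 := by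
    field_simp
  linarith

/-! ### Geometry of boxes -/

/-- A point outside a box lies strictly beyond it in some coordinate direction. -/
theorem IsAxisParallelBox.exists_separating_direction {d : ℕ} {B : Set (Fin d → ℝ)}
    (hB : IsAxisParallelBox B) {p : Fin d → ℝ} (hp : p ∉ B) :
    ∃ c : Fin d × Bool, ∀ q ∈ B, if c.2 then q c.1 < p c.1 else p c.1 < q c.1 := by
  obtain ⟨I, hI, rfl⟩ := hB
  simp only [Set.mem_univ_pi, not_forall] at hp
  obtain ⟨i, hi⟩ := hp
  by_cases h : ∀ t ∈ I i, t < p i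
  · exact ⟨(i, true), fun q hq => by simpa using h _ (hq i trivial)⟩
  · refine ⟨(i, false), fun q hq => ?_⟩
    push Not at h
    obtain ⟨t, ht, hpt⟩ := h
    by_contra hqp
    simp only [Bool.false_eq_true, if_false, not_lt] at hqp
    exact hi ((hI i).2.2.out (hq i trivial) ht ⟨hqp, hpt⟩)

/-- Among many boxes with a chosen common point for every pair, one of the chosen points lies in a
third box. -/
theorem exists_pair_point_mem_third_box {d m : ℕ} (hd : 0 < d) (hm : 2 ^ 2 ^ (d * 2) < m)
    (B : Fin m → Set (Fin d → ℝ)) (hB : ∀ j, IsAxisParallelBox (B j))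
    (p : Fin m → Fin m → Fin d → ℝ) (hp : ∀ i j, i < j → p i j ∈ B i ∧ p i j ∈ B j) :
    ∃ i j k, i < j ∧ j < k ∧ p i k ∈ B j := by
  by_contra! h
  have hsep : ∀ i j k : Fin m, ∃ c : Fin d × Bool, i < j → j < k →
      ∀ q ∈ B j, if c.2 then q c.1 < p i k c.1 else p i k c.1 < q c.1 := by
    intro i j k
    by_cases hijk : i < j ∧ j < k
    · obtain ⟨c, hc⟩ := (hB j).exists_separating_direction (h i j k hijk.1 hijk.2)
      exact ⟨c, fun _ _ => hc⟩
    -- Arbitrary colour off increasing triples; its existence needs `0 < d`.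
    · exact ⟨(⟨0, hd⟩, true), fun h1 h2 => absurd ⟨h1, h2⟩ hijk⟩
  choose f hf using hsep
  obtain ⟨i, j, k, l, hij, hjk, hkl, he⟩ :=
    exists_consecutive_triples_eq_color (V := Fin m) (C := Fin d × Bool) (by simpa using hm) f
  have h1 := hf i j k hij hjk _ (hp j l (hjk.trans hkl)).1
  have h2 := hf j k l hjk hkl _ (hp i k (hij.trans hjk)).2
  rw [he] at h1
  split_ifs at h1 h2 <;> exact lt_asymm h1 h2

/-! ### Counting bad pairs and triples -/

open Classical in
/-- Ordered pairs that coincide or are not `S`-intersecting are few if most unordered pairs are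
`S`-intersecting. -/
theorem card_bad_ordered_pairs_le {d n : ℕ} (S : Set (Fin d → ℝ)) (F : Fin n → Set (Fin d → ℝ))
    {α : ℝ} (hα : α ≤ 1) (h : α * (n.choose 2 : ℝ) ≤ (numSIntersectingPairs S F : ℝ)) :
    ((Finset.univ.filter fun t : Fin 2 → Fin n =>
      t 0 = t 1 ∨ ¬ IsSIntersecting S F {t 0, t 1}).card : ℝ) ≤
      n + 2 * (1 - α) * (n : ℝ) ^ 2 := by
  set T : Finset (Fin 2 → Fin n) :=
    Finset.univ.filter fun t => t 0 ≠ t 1 ∧ ¬ IsSIntersecting S F {t 0, t 1} with hT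
  set N := (Finset.powersetCard 2 (Finset.univ : Finset (Fin n))).filter
    (fun J => ¬ IsSIntersecting S F J) with hN
  have hdiag : (Finset.univ.filter fun t : Fin 2 → Fin n => t 0 = t 1).card ≤ n := by
    have := Finset.card_le_card_of_injOn (s := Finset.univ.filter fun t : Fin 2 → Fin n => t 0 = t 1)
      (t := (Finset.univ : Finset (Fin n))) (fun t => t 0) (fun _ _ => by simp) (by
        intro t ht t' ht' he
        simp only [Finset.coe_filter, Finset.mem_univ, true_and, Set.mem_ofPred_eq] at ht ht'
        funext x
        fin_cases x
        · exact he
        · exact ht.symm.trans (Eq.trans he ht'))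
    simpa using this
  have hsub : (Finset.univ.filter fun t : Fin 2 → Fin n =>
      t 0 = t 1 ∨ ¬ IsSIntersecting S F {t 0, t 1}) ⊆
      (Finset.univ.filter fun t : Fin 2 → Fin n => t 0 = t 1) ∪ T := by
    intro t ht
    simp only [hT, Finset.mem_union, Finset.mem_filter, Finset.mem_univ, true_and] at ht ⊢
    tauto
  -- Crude factor: each fibre embeds in `J ×ˢ J`.
  have hTN : T.card ≤ 4 * N.card := by
    refine Finset.card_le_mul_card_image_of_maps_to (f := fun t => ({t 0, t 1} : Finset (Fin n)))
      ?_ 4 ?_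
    · intro t ht
      simp only [hT, hN, Finset.mem_filter, Finset.mem_univ, true_and, Finset.mem_powersetCard,
        Finset.subset_univ] at ht ⊢
      exact ⟨Finset.card_pair ht.1, ht.2⟩
    · intro J hJ
      have hJ2 : J.card = 2 := (Finset.mem_powersetCard.1 (Finset.mem_filter.1 hJ).1).2
      have := Finset.card_le_card_of_injOn
        (s := T.filter fun t => ({t 0, t 1} : Finset (Fin n)) = J) (t := J ×ˢ J)
        (fun t => (t 0, t 1)) (by
          intro t ht
          have := (Finset.mem_filter.1 ht).2
          simp [← this]) (by
          intro t _ t' _ he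
          simp only [Prod.mk.injEq] at he
          funext x
          fin_cases x
          · exact he.1
          · exact he.2)
      simpa [Finset.card_product, hJ2] using this
  have hsplit : numSIntersectingPairs S F + N.card = n.choose 2 := by
    have := Finset.card_filter_add_card_filter_not
      (s := Finset.powersetCard 2 (Finset.univ : Finset (Fin n))) (fun J => IsSIntersecting S F J)
    simpa [numSIntersectingPairs, Finset.card_powersetCard] using this
  have hsplit' : (numSIntersectingPairs S F : ℝ) + N.card = n.choose 2 := by exact_mod_cast hsplit
  have hchoose : (n.choose 2 : ℝ) ≤ (n : ℝ) ^ 2 / 2 := by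
    rw [Nat.cast_choose_two]
    nlinarith [(Nat.cast_nonneg n : (0 : ℝ) ≤ n)]
  have hNle : (N.card : ℝ) ≤ (1 - α) * ((n : ℝ) ^ 2 / 2) := by
    have := mul_le_mul_of_nonneg_left hchoose (sub_nonneg.2 hα)
    linarith
  have hle : ((Finset.univ.filter fun t : Fin 2 → Fin n =>
      t 0 = t 1 ∨ ¬ IsSIntersecting S F {t 0, t 1}).card : ℝ) ≤ n + 4 * N.card := by
    exact_mod_cast (Finset.card_le_card hsub).trans
      ((Finset.card_union_le _ _).trans (add_le_add hdiag hTN))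
  linarith

open Classical in
/-- If each point `p x z` satisfies few of the predicates `R · y`, few triples are bad. -/
theorem card_bad_triples_le {n : ℕ} (R : Fin n → Fin n → Fin n → Prop) {b : ℝ}
    (h : ∀ x z, ((Finset.univ.filter fun y => R x y z).card : ℝ) ≤ b) :
    ((Finset.univ.filter fun t : Fin 3 → Fin n => R (t 0) (t 1) (t 2)).card : ℝ) ≤
      b * (n : ℝ) ^ 2 := by
  have hinj : (Finset.univ.filter fun t : Fin 3 → Fin n => R (t 0) (t 1) (t 2)).card ≤
      ((Finset.univ : Finset (Fin n × Fin n)).sigma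
        fun xz => Finset.univ.filter fun y => R xz.1 y xz.2).card := by
    refine Finset.card_le_card_of_injOn (fun t => ⟨(t 0, t 2), t 1⟩) ?_ ?_
    · intro t ht
      simpa using ht
    · intro t _ t' _ he
      simp only [Sigma.mk.injEq, Prod.mk.injEq, heq_eq_eq] at he
      funext x
      fin_cases x
      · exact he.1.1
      · exact he.2
      · exact he.1.2
  rw [Finset.card_sigma] at hinj
  calc ((Finset.univ.filter fun t : Fin 3 → Fin n => R (t 0) (t 1) (t 2)).card : ℝ)
      ≤ ∑ xz : Fin n × Fin n, ((Finset.univ.filter fun y => R xz.1 y xz.2).card : ℝ) := by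
        exact_mod_cast hinj
    _ ≤ ∑ _xz : Fin n × Fin n, b := Finset.sum_le_sum fun xz _ => h xz.1 xz.2
    _ = b * (n : ℝ) ^ 2 := by simp [sq, mul_comm]

theorem exists_two_SIntersecting_of_numSIntersectingPairs_pos {d n : ℕ} {S : Set (Fin d → ℝ)}
    {F : Fin n → Set (Fin d → ℝ)} (h : 0 < numSIntersectingPairs S F) :
    ∃ J : Finset (Fin n), IsSIntersecting S F J ∧ J.card = 2 := by
  classical
  obtain ⟨J, hJ⟩ := Finset.card_pos.1 h
  have hJ' := Finset.mem_filter.1 hJ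
  exact ⟨J, hJ'.2, (Finset.mem_powersetCard.1 hJ'.1).2⟩

theorem theorem1p1 (d : ℕ) (hd : 1 ≤ d) :
    ∃ c : ℝ, c ∈ Set.Ioo (0 : ℝ) 1 ∧
      ∃ β : ℝ → ℝ, (∀ α ∈ Set.Ioc c 1, β α ∈ Set.Ioc (0 : ℝ) 1) ∧
        ∀ (S : Set (Fin d → ℝ)), ∀ α ∈ Set.Ioc c 1,
          ∀ (n : ℕ), 2 ≤ n → ∀ (F : Fin n → Set (Fin d → ℝ)), (∀ j, IsAxisParallelBox (F j)) →
            α * (n.choose 2 : ℝ) ≤ (numSIntersectingPairs S F : ℝ) →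
              ∃ J : Finset (Fin n), IsSIntersecting S F J ∧ β α * (n : ℝ) ≤ (J.card : ℝ) := by
  classical
  obtain ⟨m, hm⟩ : ∃ m : ℕ, 2 ^ 2 ^ (d * 2) < m := ⟨_, Nat.lt_succ_self _⟩
  have hm1 : 1 ≤ m := Nat.one_le_of_lt hm
  set ε : ℝ := 1 / (4 * (m : ℝ) ^ 3) with hε
  have hm1' : (1 : ℝ) ≤ m := by exact_mod_cast hm1
  have hm3 : (1 : ℝ) ≤ (m : ℝ) ^ 3 := one_le_pow₀ hm1'
  have hε0 : 0 < ε := by positivity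
  have hε1 : ε ≤ 1 / 4 := by
    rw [hε]
    exact one_div_le_one_div_of_le (by norm_num) (by linarith)
  -- With `1 - α < ε / 4`, non-intersecting pairs cost at most `ε n² / 2`; the `n` diagonal pairs
  -- cost as little once `ε n > 2`. If `ε n ≤ 2`, one intersecting pair is already large enough.
  refine ⟨1 - ε / 4, ⟨by linarith, by linarith⟩, fun _ => ε, fun _ _ => ⟨hε0, by linarith⟩, ?_⟩
  intro S α hα n hn F hF hpairs
  have hn' : (2 : ℝ) ≤ n := by exact_mod_cast hn
  by_cases hsmall : ε * n ≤ 2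
  · have hpos : 0 < numSIntersectingPairs S F := by
      have h1 : (0 : ℝ) < n.choose 2 := by exact_mod_cast Nat.choose_pos hn
      have h2 : 0 < α * (n.choose 2 : ℝ) := mul_pos (by linarith [hα.1]) h1
      exact_mod_cast h2.trans_le hpairs
    obtain ⟨J, hJ, hJ2⟩ := exists_two_SIntersecting_of_numSIntersectingPairs_pos hpos
    exact ⟨J, hJ, by rw [hJ2]; exact_mod_cast hsmall⟩
  push Not at hsmall
  by_contra! hcon
  have hpoint : ∀ x z : Fin n, ∃ q : Fin d → ℝ,
      IsSIntersecting S F {x, z} → q ∈ S ∧ q ∈ F x ∧ q ∈ F z := by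
    intro x z
    by_cases h : IsSIntersecting S F {x, z}
    · obtain ⟨q, hqS, hq⟩ := h
      simp only [Finset.mem_insert, Finset.mem_singleton, Set.iInter_iInter_eq_or_left,
        Set.iInter_iInter_eq_left, Set.mem_inter_iff] at hq
      exact ⟨q, fun _ => ⟨hqS, hq⟩⟩
    · exact ⟨0, fun h' => absurd h' h⟩
  choose p hp using hpoint
  set P := Finset.univ.filter fun t : Fin 2 → Fin n =>
    t 0 = t 1 ∨ ¬ IsSIntersecting S F {t 0, t 1} with hPdef
  -- Requiring the point to be in `S` keeps default values of `p` outside `S` from being counted.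
  set Q := Finset.univ.filter fun t : Fin 3 → Fin n =>
    p (t 0) (t 2) ∈ S ∧ p (t 0) (t 2) ∈ F (t 1) with hQdef
  have hP : (P.card : ℝ) ≤ ε * (n : ℝ) ^ 2 := by
    refine (card_bad_ordered_pairs_le S F hα.2 hpairs).trans ?_
    have h1 : (1 - α) * (n : ℝ) ^ 2 ≤ ε / 4 * (n : ℝ) ^ 2 := by
      have := hα.1
      gcongr
      linarith
    nlinarith
  have hQ : (Q.card : ℝ) ≤ ε * (n : ℝ) ^ 3 := by
    have h1 := card_bad_triples_le (n := n) (fun x y z => p x z ∈ S ∧ p x z ∈ F y)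
      (b := ε * n) (by
        intro x z
        by_cases hS : p x z ∈ S
        · refine (hcon _ ⟨p x z, hS, ?_⟩).le
          simp
        · simp only [hS, false_and, Finset.filter_false, Finset.card_empty, Nat.cast_zero]
          positivity)
    calc (Q.card : ℝ) ≤ ε * n * (n : ℝ) ^ 2 := by convert h1
      _ = _ := by ring
  obtain ⟨g, hg2, hg3⟩ := exists_tuple_avoiding hm1 (by omega) P Q hP hQ
  have hint : ∀ i j : Fin m, i < j → IsSIntersecting S F {g i, g j} := by
    intro i j hij
    have h1 := hg2 ⟨![i, j], (Fin.strictMono_iff_lt_succ.2 fun a => by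
      fin_cases a; exact hij).injective⟩
    simp only [hPdef, Finset.mem_filter, Finset.mem_univ, true_and, not_or, not_not] at h1
    exact h1.2
  obtain ⟨i, j, k, hij, hjk, hmem⟩ := exists_pair_point_mem_third_box hd hm
    (fun a => F (g a)) (fun a => hF _) (fun a b => p (g a) (g b))
    (fun a b hab => (hp _ _ (hint a b hab)).2)
  have hik := hij.trans hjk
  refine hg3 ⟨![i, j, k], (Fin.strictMono_iff_lt_succ.2 fun a => ?_).injective⟩ ?_
  · fin_cases a
    · exact hij
    · exact hjk
  · simp only [hQdef, Finset.mem_filter, Finset.mem_univ, true_and]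
    exact ⟨(hp _ _ (hint i k hik)).1, hmem⟩
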